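/- Let $d\ge 1$, let $\rho,\sigma$ be quantum states (density matrices) on a $d$-dimensional Hilbert space, let $\varepsilon\ge 0$ and $p\in[1,\infty]$. Let $\Delta_d^{\downarrow}$ be the set of probability vectors $x\in\mathbb{R}^d$ with $x_1\ge\dots\ge x_d$, and let $x(\rho),x(\sigma)\in\Delta_d^{\downarrow}$ be the vectors of eigenvalues (with multiplicity) of $\rho$ and $\sigma$ sorted in non-increasing order. For $x,y\in\Delta_d^{\downarrow}$ write $x\succeq y$ ($x$ majorizes $y$) if $\sum_{i\le k}x_i\ge\sum_{i\le k}y_i$ for all $1\le k\le d-1$. Fix one of the following three classes of free operations on $d\times d$ matrices: mixtures of unitaries $A\mapsto\sum_i p_iU_iAU_i^\dagger$ (a finite sum with $U_i$ unitary and $(p_i)$ a probability vector); noisy operations $A\mapsto\operatorname{tr}_E\big(U(A\otimes I_E/d_E)U^\dagger\big)$ with $U$ unitary and $E$ an environment of some finite dimension $d_E\ge1$; unital operations, i.e. completely positive trace-preserving linear maps $\mathcal{E}$ with $\mathcal{E}(I/d)=I/d$. Write $\rho\mapsto\sigma$ if $\sigma=\mathcal{E}(\rho)$ for some free operation $\mathcal{E}$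 of that class. Let $\|\cdot\|_p$ denote the $\ell^p$-norm on vectors and the Schatten $p$-norm on matrices, $\|A\|_p=(\operatorname{tr}|A|^p)^{1/p}$ for $p<\infty$ and the operator norm for $p=\infty$. Then, for each of the three classes, (i) is equivalent to (ii), and (iii) is equivalent to (iv): (i) there is a quantum state $\sigma'$ on the same space with $\rho\mapsto\sigma'$ and $\|\sigma-\sigma'\|_p\le\varepsilon$ (approximate post-conversion); (ii) there is $y'\in\Delta_d^{\downarrow}$ with $x(\rho)\succeq y'$ and $\|y'-x(\sigma)\|_p\le\varepsilon$ ($x(\rho)$ $\varepsilon$-post-majorizes $x(\sigma)$); (iii) there is a quantum state $\rho'$ on the same space with $\rho'\mapsto\sigma$ and $\|\rho-\rho'\|_p\le\varepsilon$ (approximate pre-conversion); (iv) there is $x'\in\Delta_d^{\downarrow}$ with $x'\succeq x(\sigma)$ and $\|x'-x(\rho)\|_p\le\varepsilon$ ($x(\rho)$ $\varepsilon$-pre-majorizes $x(\sigma)$). -/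

import Mathlib

open scoped ENNReal Kronecker Matrix ComplexOrder

noncomputable section

namespace Nonuniformity

/-! ### Probability vectors and majorization -/

/-- The set `Δ_d^↓` of probability vectors of length `d` with entries in non-increasing order. -/
def orderedSimplex (d : ℕ) : Set (Fin d → ℝ) :=
  {x | x ∈ stdSimplex ℝ (Fin d) ∧ Antitone x}

/-- The rearrangement `x^↓` of `x` in non-increasing order. -/
def decreasing {d : ℕ} (x : Fin d → ℝ) : Fin d → ℝ :=
  x ∘ Tuple.sort (fun i => -x i)

/-- The partial sum `s_k(x)` of the first `k` entries. -/
def partialSum {d : ℕ} (k : ℕ) (x : Fin d → ℝ) : ℝ :=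
  ∑ i : Fin d with i.val < k, x i

/-- `x` majorizes `y`, for probability vectors `x` and `y` (whose total sums agree). -/
def Majorizes {d : ℕ} (x y : Fin d → ℝ) : Prop :=
  ∀ k : ℕ, 1 ≤ k → k ≤ d - 1 → partialSum k (decreasing y) ≤ partialSum k (decreasing x)

/-- `x` `ε`-post-majorizes `y` with respect to the distance `D`. -/
def PostMajorizes {d : ℕ} (D : orderedSimplex d → orderedSimplex d → ℝ) (ε : ℝ)
    (x y : orderedSimplex d) : Prop :=
  ∃ y' : orderedSimplex d, Majorizes (x : Fin d → ℝ) y' ∧ D y' y ≤ ε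

/-- `x` `ε`-pre-majorizes `y` with respect to the distance `D`. -/
def PreMajorizes {d : ℕ} (D : orderedSimplex d → orderedSimplex d → ℝ) (ε : ℝ)
    (x y : orderedSimplex d) : Prop :=
  ∃ x' : orderedSimplex d, Majorizes (x' : Fin d → ℝ) y ∧ D x' x ≤ ε

/-- The distance induced by the `ℓ^p` norm, `1 ≤ p ≤ ∞`. -/
def lpDist {d : ℕ} (p : ℝ≥0∞) (x y : orderedSimplex d) : ℝ :=
  ‖WithLp.toLp p ((x : Fin d → ℝ) - (y : Fin d → ℝ))‖

/-! ### Quantum states -/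

/-- Quantum states of a `d`-dimensional system: positive semidefinite matrices of trace one. -/
structure State (d : ℕ) where
  /-- the density matrix -/
  mat : Matrix (Fin d) (Fin d) ℂ
  posSemidef : mat.PosSemidef
  trace_eq_one : mat.trace = 1

/-- The eigenvalues, with multiplicity and in non-increasing order, of a state. -/
def eigenvalueVector {d : ℕ} (ρ : State d) : Fin d → ℝ :=
  fun i => ρ.posSemidef.isHermitian.eigenvalues₀ (Fin.cast (Fintype.card_fin d).symm i)

theorem eigenvalueVector_mem {d : ℕ} (ρ : State d) :
    eigenvalueVector ρ ∈ orderedSimplex d := by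
  have hA := ρ.posSemidef.isHermitian
  have key : ∀ i : Fin (Fintype.card (Fin d)), hA.eigenvalues₀ i =
      hA.eigenvalues (Fintype.equivOfCardEq (Fintype.card_fin _) i) := by
    intro i
    simp [Matrix.IsHermitian.eigenvalues]
  refine ⟨⟨fun i => ?_, ?_⟩, fun i j hij => hA.eigenvalues₀_antitone (by simpa using hij)⟩
  · change 0 ≤ hA.eigenvalues₀ _
    rw [key]
    exact ρ.posSemidef.eigenvalues_nonneg _
  · have h1 : ∑ i, eigenvalueVector ρ i = ∑ i, hA.eigenvalues₀ i :=
      Equiv.sum_comp (finCongr (Fintype.card_fin d).symm) hA.eigenvalues₀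
    have h2 : ∑ i, hA.eigenvalues₀ i = ∑ i, hA.eigenvalues i := by
      simp_rw [key]
      exact Equiv.sum_comp _ hA.eigenvalues
    have h3 := hA.trace_eq_sum_eigenvalues
    rw [ρ.trace_eq_one] at h3
    rw [h1, h2]
    have h4 : ((1 : ℝ) : ℂ) = ((∑ i, hA.eigenvalues i : ℝ) : ℂ) := by
      simpa using h3
    exact (Complex.ofReal_injective h4).symm

/-- The vector `x(ρ)` of sorted eigenvalues, as an element of `Δ_d^↓`. -/
def spec {d : ℕ} (ρ : State d) : orderedSimplex d :=
  ⟨eigenvalueVector ρ, eigenvalueVector_mem ρ⟩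

/-- The Schatten `p`-norm: `(tr |A|^p)^(1/p)` with `|A|^p = (Aᴴ A)^(p/2)` (functional calculus)
for finite `p`, and the operator norm on Euclidean space for `p = ∞`. -/
def schattenNorm {d : ℕ} (p : ℝ≥0∞) (A : Matrix (Fin d) (Fin d) ℂ) : ℝ :=
  if p = ∞ then ‖Matrix.toEuclideanCLM (n := Fin d) (𝕜 := ℂ) A‖
  else (Matrix.trace (cfc (fun t : ℝ => t ^ (p.toReal / 2)) (Aᴴ * A))).re ^ (1 / p.toReal)

/-- The distance induced by the Schatten `p`-norm. -/
def schattenDist {d : ℕ} (p : ℝ≥0∞) (ρ σ : State d) : ℝ :=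
  schattenNorm p (ρ.mat - σ.mat)

/-! ### Free operations -/

/-- Linear maps on the `d × d` matrices. -/
abbrev SuperOp (d : ℕ) : Type :=
  Matrix (Fin d) (Fin d) ℂ →ₗ[ℂ] Matrix (Fin d) (Fin d) ℂ

/-- The map `id_k ⊗ E` on `k × k` block matrices with blocks of size `d × d`. -/
def ampliation {d : ℕ} (k : ℕ) (E : SuperOp d) (M : Matrix (Fin k × Fin d) (Fin k × Fin d) ℂ) :
    Matrix (Fin k × Fin d) (Fin k × Fin d) ℂ :=
  Matrix.of fun a b => E (Matrix.of fun i j => M (a.1, i) (b.1, j)) a.2 b.2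

/-- Quantum operations: completely positive and trace preserving linear maps. -/
structure IsQuantumOperation {d : ℕ} (E : SuperOp d) : Prop where
  completelyPositive : ∀ (k : ℕ) (M : Matrix (Fin k × Fin d) (Fin k × Fin d) ℂ),
    M.PosSemidef → (ampliation k E M).PosSemidef
  tracePreserving : ∀ A, (E A).trace = A.trace

/-- The matrix `I / m` of the maximally mixed state. -/
def maxMixed (m : ℕ) : Matrix (Fin m) (Fin m) ℂ :=
  (1 / (m : ℂ)) • (1 : Matrix (Fin m) (Fin m) ℂ)

/-- The partial trace over the second tensor factor. -/
def partialTrace {d m : ℕ} (M : Matrix (Fin d × Fin m) (Fin d × Fin m) ℂ) :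
    Matrix (Fin d) (Fin d) ℂ :=
  Matrix.of fun i j => ∑ k, M (i, k) (j, k)

/-- Mixtures of unitaries. -/
def IsMixtureOfUnitaries {d : ℕ} (E : SuperOp d) : Prop :=
  ∃ (m : ℕ) (w : Fin m → ℝ) (U : Fin m → Matrix (Fin d) (Fin d) ℂ),
    w ∈ stdSimplex ℝ (Fin m) ∧ (∀ i, U i ∈ Matrix.unitaryGroup (Fin d) ℂ) ∧
    ∀ A, E A = ∑ i, (w i : ℂ) • (U i * A * (U i)ᴴ)

/-- Noisy operations: a joint unitary with a maximally mixed environment (of some finite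
dimension `m ≥ 1`), which is then traced out. -/
def IsNoisy {d : ℕ} (E : SuperOp d) : Prop :=
  ∃ (m : ℕ) (U : Matrix (Fin d × Fin m) (Fin d × Fin m) ℂ),
    1 ≤ m ∧ U ∈ Matrix.unitaryGroup (Fin d × Fin m) ℂ ∧
    ∀ A, E A = partialTrace (U * (A ⊗ₖ maxMixed m) * Uᴴ)

/-- Unital operations: quantum operations that preserve the maximally mixed state. -/
def IsUnital {d : ℕ} (E : SuperOp d) : Prop :=
  IsQuantumOperation E ∧ E (maxMixed d) = maxMixed d

/-- The three classes of free operations: mixtures of unitaries, noisy and unital operations. -/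
inductive FreeClass : Type
  | MU
  | NO
  | U

/-- `E` is a free operation of the class `X`. -/
def IsFree {d : ℕ} (X : FreeClass) (E : SuperOp d) : Prop :=
  match X with
  | .MU => IsMixtureOfUnitaries E
  | .NO => IsNoisy E
  | .U => IsUnital E

/-- `ρ ↦ σ` by a free operation of the class `X`. -/
def Converts {d : ℕ} (X : FreeClass) (ρ σ : State d) : Prop :=
  ∃ E : SuperOp d, IsFree X E ∧ σ.mat = E ρ.mat

/-- Approximate post-conversion: `ρ` is converted into some `σ'` within distance `ε` of `σ`. -/
def PostConverts {d : ℕ} (X : FreeClass) (D : State d → State d → ℝ) (ε : ℝ)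
    (ρ σ : State d) : Prop :=
  ∃ σ' : State d, Converts X ρ σ' ∧ D σ σ' ≤ ε

/-- Approximate pre-conversion: some `ρ'` within distance `ε` of `ρ` is converted into `σ`. -/
def PreConverts {d : ℕ} (X : FreeClass) (D : State d → State d → ℝ) (ε : ℝ)
    (ρ σ : State d) : Prop :=
  ∃ ρ' : State d, Converts X ρ' σ ∧ D ρ ρ' ≤ ε

end Nonuniformity

end

open scoped ENNReal Kronecker Matrix ComplexOrder

noncomputable section

namespace Nonuniformity

/-! ### Partial sums and T-transforms -/

/-! Two facts carry the result. First, for every class, exact conversion of states is the same as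
majorization of their spectra. The three classes are squeezed between uniform mixtures of unitaries,
which lie in all of them, and positive, unital, trace-preserving maps, which contain all of them.
Such a map, read in the eigenbases of input and output, acts on eigenvalues by a doubly stochastic
matrix, so majorization follows (`Converts.majorizes`). Conversely, majorization factors into
T-transforms, and each T-transform of a diagonal matrix is an average of two unitary conjugates with
equal weights (`converts_of_majorizes`).

Second, passing to sorted spectra does not increase distance, by Lidskii's inequality
(`lpDist_spec_le_schattenDist`), and it preserves distance when both states are diagonal in one
basis with eigenvalues in the same order (`schattenDist_conjDiagonalState`).

Hence a nearby state yields a nearby vector by taking its spectrum. A nearby vector yields a nearby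
state by placing it on the eigenbasis of the target (post) or of the source (pre). -/

theorem partialSum_zero {d : ℕ} (x : Fin d → ℝ) : partialSum 0 x = 0 := by
  simp [partialSum]

theorem partialSum_of_le {d k : ℕ} (hk : d ≤ k) (x : Fin d → ℝ) :
    partialSum k x = ∑ i, x i := by
  unfold partialSum
  rw [Finset.filter_true_of_mem]
  intro i _
  exact lt_of_lt_of_le i.2 hk

theorem decreasing_antitone {d : ℕ} (x : Fin d → ℝ) : Antitone (decreasing x) := by
  intro i j hij
  have := Tuple.monotone_sort (fun i => -x i) hij
  simpa [decreasing] using this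

theorem decreasing_eq_self {d : ℕ} {x : Fin d → ℝ} (hx : Antitone x) : decreasing x = x := by
  have h : Tuple.sort (fun i => -x i) = Equiv.refl _ :=
    Tuple.sort_eq_refl_iff_monotone.2 fun i j hij => neg_le_neg (hx hij)
  simp [decreasing, h]

theorem majorizes_iff_partialSum_le {d : ℕ} {x y : Fin d → ℝ} (hx : x ∈ orderedSimplex d)
    (hy : y ∈ orderedSimplex d) :
    Majorizes x y ↔ ∀ k, partialSum k y ≤ partialSum k x := by
  unfold Majorizes
  rw [decreasing_eq_self hx.2, decreasing_eq_self hy.2]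
  refine ⟨fun h k => ?_, fun h k _ _ => h k⟩
  rcases Nat.eq_zero_or_pos k with rfl | hk
  · simp [partialSum_zero]
  · rcases lt_or_ge k d with hkd | hkd
    · exact h k hk (by omega)
    · rw [partialSum_of_le hkd, partialSum_of_le hkd, hx.1.2, hy.1.2]

/-- `x'` arises from `x` by a T-transform: a mixture of the identity and a transposition. -/
def TTransform {d : ℕ} (x x' : Fin d → ℝ) : Prop :=
  ∃ (i j : Fin d) (t : ℝ), 0 ≤ t ∧ t ≤ 1 ∧ x' = t • x + (1 - t) • (x ∘ Equiv.swap i j)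

/-- Swapping `j` and `k` moves the full gap `x j - x k`; swapping with weight `δ / (x j - x k)`
moves exactly `δ`. -/
theorem tTransform_sub_single {d : ℕ} {x : Fin d → ℝ} {j k : Fin d} {δ : ℝ} (hδ : 0 ≤ δ)
    (h : δ ≤ x j - x k) (hlt : x k < x j) :
    TTransform x (x - δ • (Pi.single j 1 - Pi.single k 1)) := by
  have hpos : 0 < x j - x k := sub_pos.2 hlt
  have hjk : j ≠ k := by rintro rfl; exact lt_irrefl _ hlt
  refine ⟨j, k, 1 - δ / (x j - x k), ?_, ?_, ?_⟩
  · rw [sub_nonneg, div_le_one hpos]; exact h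
  · have := div_nonneg hδ hpos.le
    linarith
  · have hd : δ / (x j - x k) * (x j - x k) = δ := div_mul_cancel₀ _ hpos.ne'
    ext i
    by_cases hij : i = j
    · subst hij
      simp [hjk]
      linear_combination hd
    · by_cases hik : i = k
      · subst hik
        simp [hij]
        linear_combination -hd
      · simp [hij, hik, Equiv.swap_apply_of_ne_of_ne hij hik]
        ring

/-- The Hardy–Littlewood–Pólya step: move mass from a surplus coordinate to the first deficit
coordinate until one of them is correct. The number of wrong coordinates then drops, which drives
the induction. Only `y` has to be sorted, so the intermediate vectors need no re-sorting. -/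
theorem exists_tTransform_of_partialSum_le {d : ℕ} {x y : Fin d → ℝ} (hy : Antitone y)
    (hsum : ∑ i, x i = ∑ i, y i) (h : ∀ k, partialSum k y ≤ partialSum k x) (hne : x ≠ y) :
    ∃ x', TTransform x x' ∧ ∑ i, x' i = ∑ i, y i ∧
      (∀ k, partialSum k y ≤ partialSum k x') ∧
      ({i | x' i ≠ y i} : Finset (Fin d)) ⊂ ({i | x i ≠ y i} : Finset (Fin d)) := by
  have hex : {k : Fin d | x k < y k}.Nonempty := by
    by_contra hcon
    rw [Set.not_nonempty_iff_eq_empty] at hcon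
    have hle : ∀ i, y i ≤ x i := fun i => by
      by_contra hi
      have : i ∈ {k : Fin d | x k < y k} := not_le.1 hi
      rw [hcon] at this
      exact this
    apply hne
    funext i
    exact (((Finset.sum_eq_sum_iff_of_le fun i _ => hle i).1 hsum.symm) i (Finset.mem_univ i)).symm
  obtain ⟨k, hk, hmin⟩ := WellFounded.has_min (wellFounded_lt (α := Fin d)) _ hex
  have hk : x k < y k := hk
  have hbelow : ∀ i, i < k → y i ≤ x i := fun i hi => by
    by_contra hc
    exact hmin i (not_le.1 hc) hi
  obtain ⟨j, hjk, hj⟩ : ∃ j, j < k ∧ y j < x j := by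
    -- Without an earlier surplus, the partial sum of `x` through index `k` would fall strictly
    -- below that of `y`.
    by_contra! hcon
    refine absurd (h (k + 1)) (not_le.2 ?_)
    refine Finset.sum_lt_sum (fun i hi => ?_) ⟨k, by simp, hk⟩
    have hik : i ≤ k := by
      have := (Finset.mem_filter.1 hi).2
      exact Fin.le_def.2 (by omega)
    rcases hik.lt_or_eq with hlt | rfl
    · exact hcon i hlt
    · exact hk.le
  -- The largest transfer that overshoots neither target; the minimum makes one of the two
  -- coordinates exact.
  set δ := min (x j - y j) (y k - x k) with hδ
  have hδ1 : δ ≤ x j - y j := min_le_left _ _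
  have hδ2 : δ ≤ y k - x k := min_le_right _ _
  have hδ0 : 0 < δ := lt_min (by linarith) (by linarith)
  have hyjk := hy hjk.le
  have hne' : j ≠ k := hjk.ne
  have xj : (x - δ • (Pi.single j 1 - Pi.single k 1) : Fin d → ℝ) j = x j - δ := by
    simp [hne']
  have xk : (x - δ • (Pi.single j 1 - Pi.single k 1) : Fin d → ℝ) k = x k + δ := by
    simp [hne'.symm]
  have xo : ∀ i, i ≠ j → i ≠ k →
      (x - δ • (Pi.single j 1 - Pi.single k 1) : Fin d → ℝ) i = x i := fun i h1 h2 => by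
    simp [h1, h2]
  refine ⟨x - δ • (Pi.single j 1 - Pi.single k 1),
    tTransform_sub_single hδ0.le (by linarith) (by linarith), ?_, ?_, ?_⟩
  · rw [← hsum]
    simp [Finset.sum_sub_distrib, ← Finset.mul_sum]
  · intro l
    by_cases hlk : k.val < l
    · refine (h l).trans (le_of_eq ?_)
      have hlj : j.val < l := lt_trans hjk hlk
      simp [partialSum, Finset.sum_sub_distrib, ← Finset.mul_sum, hlk, hlj,
        Finset.sum_pi_single']
    · refine Finset.sum_le_sum fun i hi => ?_
      have hil := (Finset.mem_filter.1 hi).2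
      have hik : i < k := Fin.lt_def.2 (by omega)
      by_cases hij : i = j
      · subst hij
        rw [xj]; linarith
      · rw [xo i hij hik.ne]
        exact hbelow i hik
  · rw [Finset.ssubset_iff_of_subset]
    · rcases min_choice (x j - y j) (y k - x k) with hm | hm
      · refine ⟨j, by simpa using hj.ne', ?_⟩
        rw [Finset.mem_filter, xj, hδ, hm]
        simp
      · refine ⟨k, by simpa using hk.ne, ?_⟩
        rw [Finset.mem_filter, xk, hδ, hm]
        simp
    · intro i hi
      rw [Finset.mem_filter] at hi ⊢
      refine ⟨Finset.mem_univ _, ?_⟩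
      by_cases hij : i = j
      · subst hij; exact hj.ne'
      by_cases hik : i = k
      · subst hik; exact hk.ne
      rw [xo i hij hik] at hi
      exact hi.2

/-- Domination of partial sums implies reachability by finitely many T-transforms. -/
theorem reflTransGen_tTransform {d : ℕ} {x y : Fin d → ℝ} (hy : Antitone y)
    (hsum : ∑ i, x i = ∑ i, y i) (h : ∀ k, partialSum k y ≤ partialSum k x) :
    Relation.ReflTransGen TTransform x y := by
  generalize hs : ({i | x i ≠ y i} : Finset (Fin d)) = s
  induction s using Finset.strongInduction generalizing x with
  | H s ih =>
    by_cases hxy : x = y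
    · subst hxy; exact .refl
    · obtain ⟨x', h1, h2, h3, h4⟩ := exists_tTransform_of_partialSum_le hy hsum h hxy
      exact .head h1 (ih _ (hs ▸ h4) h2 h3 rfl)

/-- A doubly stochastic matrix maps a sorted vector to one whose partial sums are smaller. -/
theorem partialSum_le_of_doublyStochastic {d : ℕ} {D : Fin d → Fin d → ℝ} {x y : Fin d → ℝ}
    (hD : ∀ j i, 0 ≤ D j i) (hrow : ∀ j, ∑ i, D j i = 1) (hcol : ∀ i, ∑ j, D j i = 1)
    (hy : ∀ j, y j = ∑ i, D j i * x i) (hx : Antitone x) (k : ℕ) :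
    partialSum k y ≤ partialSum k x := by
  rcases lt_or_ge k d with hkd | hkd
  · set s := x ⟨k, hkd⟩
    set w : Fin d → ℝ := fun i => ∑ j : Fin d with j.val < k, D j i
    have hw0 : ∀ i, 0 ≤ w i := fun i => Finset.sum_nonneg fun j _ => hD j i
    have hw1 : ∀ i, w i ≤ 1 := fun i => by
      rw [← hcol i]
      exact Finset.sum_le_sum_of_subset_of_nonneg (Finset.filter_subset _ _)
        fun j _ _ => hD j i
    have hwsum : ∑ i, w i = ∑ i : Fin d, if i.val < k then (1 : ℝ) else 0 := by
      rw [Finset.sum_comm, ← Finset.sum_filter]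
      exact Finset.sum_congr rfl fun j _ => hrow j
    have hyk : partialSum k y = ∑ i, w i * x i := by
      simp only [partialSum, hy, w, Finset.sum_mul]
      rw [Finset.sum_comm]
    have hxk : partialSum k x = ∑ i : Fin d, (if i.val < k then (1 : ℝ) else 0) * x i := by
      simp [partialSum, Finset.sum_filter]
    -- The weights `w` lie in [0, 1] and have total `k`, so they cannot beat the indicator of the
    -- first `k` indices. Subtracting the threshold `s` gives every term the right sign, and the
    -- equal totals make `s` cancel.
    have key : ∑ i : Fin d, (w i - if i.val < k then (1 : ℝ) else 0) * (x i - s) ≤ 0 := by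
      refine Finset.sum_nonpos fun i _ => ?_
      by_cases hi : i.val < k
      · have : s ≤ x i := hx (Fin.le_def.2 hi.le)
        simp only [hi, if_true]
        exact mul_nonpos_of_nonpos_of_nonneg (by linarith [hw1 i]) (by linarith)
      · have : x i ≤ s := hx (Fin.le_def.2 (not_lt.1 hi))
        simp only [hi, if_false, sub_zero]
        exact mul_nonpos_of_nonneg_of_nonpos (hw0 i) (by linarith)
    have expand : ∑ i : Fin d, (w i - if i.val < k then (1 : ℝ) else 0) * (x i - s) =
        (∑ i, w i * x i - ∑ i : Fin d, (if i.val < k then (1 : ℝ) else 0) * x i) -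
        (∑ i, w i - ∑ i : Fin d, if i.val < k then (1 : ℝ) else 0) * s := by
      rw [← Finset.sum_sub_distrib, ← Finset.sum_sub_distrib, Finset.sum_mul,
        ← Finset.sum_sub_distrib]
      exact Finset.sum_congr rfl fun i _ => by ring
    rw [expand, hwsum, ← hyk, ← hxk] at key
    linarith
  · rw [partialSum_of_le hkd, partialSum_of_le hkd]
    simp only [hy]
    rw [Finset.sum_comm]
    simp [← Finset.sum_mul, hcol]

/-! ### Monotonicity of the `ℓ^p` norm -/

theorem norm_toLp_comp_perm {d : ℕ} (p : ℝ≥0∞) [Fact (1 ≤ p)] (x : Fin d → ℝ)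
    (e : Equiv.Perm (Fin d)) : ‖WithLp.toLp p (x ∘ e)‖ = ‖WithLp.toLp p x‖ := by
  have := (LinearIsometryEquiv.piLpCongrLeft p ℝ ℝ e.symm).norm_map (WithLp.toLp p x)
  rw [← this]
  congr 1

/-- A T-transform is a convex combination of a vector and a permutation of it, and the norm is
convex and permutation invariant. -/
theorem norm_toLp_le_of_tTransform {d : ℕ} (p : ℝ≥0∞) [Fact (1 ≤ p)] {x x' : Fin d → ℝ}
    (h : TTransform x x') : ‖WithLp.toLp p x'‖ ≤ ‖WithLp.toLp p x‖ := by
  obtain ⟨i, j, t, h0, h1, rfl⟩ := h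
  rw [WithLp.toLp_add, WithLp.toLp_smul, WithLp.toLp_smul]
  refine (norm_add_le _ _).trans (le_of_eq ?_)
  rw [norm_smul, norm_smul, norm_toLp_comp_perm, Real.norm_of_nonneg h0,
    Real.norm_of_nonneg (sub_nonneg.2 h1)]
  ring

theorem norm_toLp_le_of_partialSum_le {d : ℕ} (p : ℝ≥0∞) [Fact (1 ≤ p)] {x y : Fin d → ℝ}
    (hy : Antitone y) (hsum : ∑ i, x i = ∑ i, y i)
    (h : ∀ k, partialSum k y ≤ partialSum k x) :
    ‖WithLp.toLp p y‖ ≤ ‖WithLp.toLp p x‖ := by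
  have := reflTransGen_tTransform hy hsum h
  clear h hsum hy
  induction this with
  | refl => exact le_rfl
  | tail _ hstep ih => exact (norm_toLp_le_of_tTransform p hstep).trans ih

/-- Majorization expressed through the functions `t ↦ (t - s)⁺` decreases the `ℓ^p` norm. -/
theorem norm_toLp_le_of_sum_posPart_le {d : ℕ} (p : ℝ≥0∞) [Fact (1 ≤ p)] {u c : Fin d → ℝ}
    (hc : Antitone c) (hsum : ∑ i, u i = ∑ i, c i)
    (h : ∀ s, ∑ i, max (u i - s) 0 ≤ ∑ i, max (c i - s) 0) :
    ‖WithLp.toLp p u‖ ≤ ‖WithLp.toLp p c‖ := by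
  have hsort : ∀ f : ℝ → ℝ, ∑ i, f (decreasing u i) = ∑ i, f (u i) := fun f =>
    Equiv.sum_comp (Tuple.sort fun i => -u i) fun i => f (u i)
  have hdec : ∑ i, decreasing u i = ∑ i, c i := (hsort id).trans hsum
  rw [← norm_toLp_comp_perm p u (Tuple.sort fun i => -u i)]
  change ‖WithLp.toLp p (decreasing u)‖ ≤ _
  refine norm_toLp_le_of_partialSum_le p (decreasing_antitone u) hdec.symm fun k => ?_
  rcases Nat.eq_zero_or_pos k with rfl | hk
  · simp [partialSum_zero]
  rcases lt_or_ge k d with hkd | hkd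
  -- At the `k`-th largest entry of `c`, the positive parts of `c - s` add up to exactly the first
  -- `k` terms, so the hypothesis at this `s` bounds the `k`-th partial sum.
  · set s := c ⟨k - 1, by omega⟩
    have h1 : ∀ z : Fin d → ℝ, ∑ i : Fin d with i.val < k, (z i - s) =
        partialSum k z - (Finset.card {i : Fin d | i.val < k} : ℝ) * s := fun z => by
      simp [partialSum, Finset.sum_sub_distrib]
    have h2 : ∑ i : Fin d with i.val < k, (decreasing u i - s) ≤ ∑ i, max (c i - s) 0 := by
      refine le_trans ?_ (h s)
      rw [← hsort fun t => max (t - s) 0]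
      refine (Finset.sum_le_sum fun i _ => le_max_left _ 0).trans ?_
      exact Finset.sum_le_sum_of_subset_of_nonneg (Finset.filter_subset _ _)
        fun i _ _ => le_max_right _ _
    have h3 : ∑ i, max (c i - s) 0 = ∑ i : Fin d with i.val < k, (c i - s) := by
      rw [Finset.sum_filter]
      refine Finset.sum_congr rfl fun i _ => ?_
      split_ifs with hi
      · exact max_eq_left (sub_nonneg.2 (hc (Fin.le_def.2 (by simp; omega))))
      · exact max_eq_right (sub_nonpos.2 (hc (Fin.le_def.2 (by simp; omega))))
    rw [h3, h1, h1] at h2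
    linarith
  · rw [partialSum_of_le hkd, partialSum_of_le hkd, hdec]

/-! ### Unitary diagonalization -/

/-- The matrix `U diag(r) Uᴴ` with real `r`. -/
def conjDiagonal {d : ℕ} (U : Matrix (Fin d) (Fin d) ℂ) (r : Fin d → ℝ) :
    Matrix (Fin d) (Fin d) ℂ :=
  U * Matrix.diagonal (fun i => (r i : ℂ)) * Uᴴ

theorem conjTranspose_mul_self_of_mem {n : Type*} [Fintype n] [DecidableEq n]
    {U : Matrix n n ℂ} (hU : U ∈ Matrix.unitaryGroup n ℂ) : Uᴴ * U = 1 :=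
  Matrix.mem_unitaryGroup_iff'.1 hU

theorem mul_conjTranspose_self_of_mem {n : Type*} [Fintype n] [DecidableEq n]
    {U : Matrix n n ℂ} (hU : U ∈ Matrix.unitaryGroup n ℂ) : U * Uᴴ = 1 :=
  Matrix.mem_unitaryGroup_iff.1 hU

theorem conjTranspose_mem_unitaryGroup {n : Type*} [Fintype n] [DecidableEq n]
    {U : Matrix n n ℂ} (hU : U ∈ Matrix.unitaryGroup n ℂ) : Uᴴ ∈ Matrix.unitaryGroup n ℂ :=
  Unitary.star_mem hU

theorem conjDiagonal_sub {d : ℕ} (U : Matrix (Fin d) (Fin d) ℂ) (r s : Fin d → ℝ) :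
    conjDiagonal U (r - s) = conjDiagonal U r - conjDiagonal U s := by
  simp only [conjDiagonal, ← Matrix.sub_mul, ← Matrix.mul_sub, Matrix.diagonal_sub]
  simp

theorem conjDiagonal_const {d : ℕ} {U : Matrix (Fin d) (Fin d) ℂ}
    (hU : U ∈ Matrix.unitaryGroup (Fin d) ℂ) (t : ℝ) :
    conjDiagonal U (fun _ => t) = (t : ℂ) • 1 := by
  rw [conjDiagonal, ← Matrix.smul_one_eq_diagonal, Matrix.mul_smul, Matrix.smul_mul,
    Matrix.mul_one, mul_conjTranspose_self_of_mem hU]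

theorem conjDiagonal_posSemidef {d : ℕ} (U : Matrix (Fin d) (Fin d) ℂ) {r : Fin d → ℝ}
    (hr : ∀ i, 0 ≤ r i) : (conjDiagonal U r).PosSemidef := by
  refine Matrix.PosSemidef.mul_mul_conjTranspose_same ?_ U
  rw [Matrix.posSemidef_diagonal_iff]
  exact fun i => by simpa using hr i

theorem conjDiagonal_conjTranspose {d : ℕ} (U : Matrix (Fin d) (Fin d) ℂ) (r : Fin d → ℝ) :
    (conjDiagonal U r)ᴴ = conjDiagonal U r := by
  simp only [conjDiagonal, Matrix.conjTranspose_mul, Matrix.conjTranspose_conjTranspose,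
    Matrix.diagonal_conjTranspose, Matrix.mul_assoc]
  congr 3
  ext i
  simp

theorem trace_conjDiagonal {d : ℕ} {U : Matrix (Fin d) (Fin d) ℂ}
    (hU : U ∈ Matrix.unitaryGroup (Fin d) ℂ) (r : Fin d → ℝ) :
    (conjDiagonal U r).trace = ((∑ i, r i : ℝ) : ℂ) := by
  rw [conjDiagonal, Matrix.trace_mul_comm, ← Matrix.mul_assoc,
    conjTranspose_mul_self_of_mem hU, Matrix.one_mul, Matrix.trace_diagonal]
  simp

theorem conjDiagonal_mul {d : ℕ} {U : Matrix (Fin d) (Fin d) ℂ}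
    (hU : U ∈ Matrix.unitaryGroup (Fin d) ℂ) (r s : Fin d → ℝ) :
    conjDiagonal U r * conjDiagonal U s = conjDiagonal U (r * s) := by
  have : conjDiagonal U r * conjDiagonal U s =
      U * (Matrix.diagonal (fun i => (r i : ℂ)) * (Uᴴ * U) *
        Matrix.diagonal (fun i => (s i : ℂ))) * Uᴴ := by
    simp only [conjDiagonal, Matrix.mul_assoc]
  rw [this, conjTranspose_mul_self_of_mem hU, Matrix.mul_one, Matrix.diagonal_mul_diagonal]
  simp [conjDiagonal]

/-- The spectral theorem with eigenvalues sorted in non-increasing order. -/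
theorem exists_eq_conjDiagonal_eigenvalues {d : ℕ} {H : Matrix (Fin d) (Fin d) ℂ}
    (hH : H.IsHermitian) :
    ∃ U ∈ Matrix.unitaryGroup (Fin d) ℂ,
      H = conjDiagonal U fun i => hH.eigenvalues₀ (Fin.cast (Fintype.card_fin d).symm i) := by
  set e : Fin d ≃ Fin d := (finCongr (Fintype.card_fin d).symm).trans
    (Fintype.equivOfCardEq (Fintype.card_fin _)) with he
  have hev : ∀ i, hH.eigenvalues (e i) =
      hH.eigenvalues₀ (Fin.cast (Fintype.card_fin d).symm i) := fun i => by
    simp [he, Matrix.IsHermitian.eigenvalues]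
  set U : Matrix (Fin d) (Fin d) ℂ := hH.eigenvectorUnitary.1
  have hU : U ∈ Matrix.unitaryGroup (Fin d) ℂ := hH.eigenvectorUnitary.2
  refine ⟨U.submatrix id e, ?_, ?_⟩
  · rw [Matrix.mem_unitaryGroup_iff, Matrix.star_eq_conjTranspose, Matrix.conjTranspose_submatrix,
      Matrix.submatrix_mul_equiv, mul_conjTranspose_self_of_mem hU, Matrix.submatrix_id_id]
  · have hdiag : Matrix.diagonal (fun i =>
        ((hH.eigenvalues₀ (Fin.cast (Fintype.card_fin d).symm i) : ℝ) : ℂ)) =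
        (Matrix.diagonal fun i => ((hH.eigenvalues i : ℝ) : ℂ)).submatrix e e := by
      rw [Matrix.submatrix_diagonal_equiv]
      congr 1
      ext i
      simp [hev]
    rw [conjDiagonal, hdiag, Matrix.conjTranspose_submatrix, Matrix.submatrix_mul_equiv,
      Matrix.submatrix_mul_equiv, Matrix.submatrix_id_id]
    exact hH.spectral_theorem

theorem exists_eq_conjDiagonal_antitone {d : ℕ} {H : Matrix (Fin d) (Fin d) ℂ}
    (hH : H.IsHermitian) :
    ∃ U ∈ Matrix.unitaryGroup (Fin d) ℂ, ∃ c : Fin d → ℝ, Antitone c ∧ H = conjDiagonal U c := by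
  obtain ⟨U, hU, h⟩ := exists_eq_conjDiagonal_eigenvalues hH
  exact ⟨U, hU, _, fun i j hij => hH.eigenvalues₀_antitone (by simpa using hij), h⟩

theorem exists_eq_conjDiagonal_spec {d : ℕ} (ρ : State d) :
    ∃ U ∈ Matrix.unitaryGroup (Fin d) ℂ, ρ.mat = conjDiagonal U (spec ρ : Fin d → ℝ) :=
  exists_eq_conjDiagonal_eigenvalues ρ.posSemidef.isHermitian

/-- The state `U diag(x) Uᴴ`. -/
def conjDiagonalState {d : ℕ} {U : Matrix (Fin d) (Fin d) ℂ}
    (hU : U ∈ Matrix.unitaryGroup (Fin d) ℂ) (x : orderedSimplex d) : State d where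
  mat := conjDiagonal U x
  posSemidef := conjDiagonal_posSemidef U x.2.1.1
  trace_eq_one := by rw [trace_conjDiagonal hU, x.2.1.2]; simp

/-! ### Eigenvalue inequalities -/

theorem star_dotProduct_conjDiagonal_mulVec {d : ℕ} (U : Matrix (Fin d) (Fin d) ℂ)
    (r : Fin d → ℝ) (v : Fin d → ℂ) :
    star v ⬝ᵥ (conjDiagonal U r *ᵥ v) =
      ((∑ i, r i * Complex.normSq ((Uᴴ *ᵥ v) i) : ℝ) : ℂ) := by
  have h : star v ᵥ* U = star (Uᴴ *ᵥ v) := by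
    rw [Matrix.star_mulVec, Matrix.conjTranspose_conjTranspose]
  rw [conjDiagonal, ← Matrix.mulVec_mulVec, ← Matrix.mulVec_mulVec, Matrix.dotProduct_mulVec, h,
    dotProduct, Complex.ofReal_sum]
  refine Finset.sum_congr rfl fun i _ => ?_
  rw [Matrix.mulVec_diagonal, Complex.ofReal_mul, Complex.normSq_eq_conj_mul_self, Pi.star_apply]
  simp only [RCLike.star_def]
  ring

theorem sum_normSq_mulVec {d : ℕ} {U : Matrix (Fin d) (Fin d) ℂ}
    (hU : U ∈ Matrix.unitaryGroup (Fin d) ℂ) (v : Fin d → ℂ) :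
    ∑ i, Complex.normSq ((Uᴴ *ᵥ v) i) = ∑ i, Complex.normSq (v i) := by
  have h1 := star_dotProduct_conjDiagonal_mulVec U (fun _ => 1) v
  rw [conjDiagonal_const hU, Complex.ofReal_one, one_smul, Matrix.one_mulVec, dotProduct] at h1
  apply Complex.ofReal_injective
  simp only [one_mul] at h1
  rw [← h1, Complex.ofReal_sum]
  exact Finset.sum_congr rfl fun i _ => by
    rw [Complex.normSq_eq_conj_mul_self, Pi.star_apply, RCLike.star_def]

/-- Weyl's monotonicity theorem. -/
theorem le_of_posSemidef_conjDiagonal_sub {d : ℕ} {U V : Matrix (Fin d) (Fin d) ℂ}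
    (hU : U ∈ Matrix.unitaryGroup (Fin d) ℂ) (hV : V ∈ Matrix.unitaryGroup (Fin d) ℂ)
    {a b : Fin d → ℝ} (ha : Antitone a) (hb : Antitone b)
    (h : (conjDiagonal V b - conjDiagonal U a).PosSemidef) (i : Fin d) : a i ≤ b i := by
  -- A kernel vector is orthogonal to the columns of `V` before `i` and of `U` after `i`. These are
  -- `d - 1` conditions, so a nonzero one exists. On it the form of `U` is at least `a i` and that
  -- of `V` at most `b i`, per unit of squared norm.
  set f : (Fin d → ℂ) →ₗ[ℂ] ({k // k ≠ i} → ℂ) :=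
    Matrix.mulVecLin (Matrix.of fun (k : {k // k ≠ i}) j => if k.1 < i then Vᴴ k j else Uᴴ k j)
  have hker : LinearMap.ker f ≠ ⊥ := by
    refine LinearMap.ker_ne_bot_of_finrank_lt ?_
    simp only [Module.finrank_fintype_fun_eq_card]
    exact Fintype.card_subtype_lt (x := i) (by simp)
  obtain ⟨v, hv, hv0⟩ := (Submodule.ne_bot_iff _).1 hker
  have hfv : ∀ k : {k // k ≠ i}, f v k = 0 := fun k => congrFun (LinearMap.mem_ker.1 hv) k
  have hVv : ∀ k, k < i → (Vᴴ *ᵥ v) k = 0 := fun k hk => by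
    have := hfv ⟨k, hk.ne⟩
    simpa [f, Matrix.mulVec, dotProduct, hk] using this
  have hUv : ∀ k, i < k → (Uᴴ *ᵥ v) k = 0 := fun k hk => by
    have := hfv ⟨k, hk.ne'⟩
    simpa [f, Matrix.mulVec, dotProduct, hk.not_gt] using this
  set N := ∑ j, Complex.normSq (v j)
  have hN : 0 < N := by
    obtain ⟨j, hj⟩ := Function.ne_iff.1 hv0
    exact Finset.sum_pos' (fun _ _ => Complex.normSq_nonneg _)
      ⟨j, Finset.mem_univ _, Complex.normSq_pos.2 hj⟩
  have hquad := h.dotProduct_mulVec_nonneg v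
  rw [Matrix.sub_mulVec, dotProduct_sub, star_dotProduct_conjDiagonal_mulVec,
    star_dotProduct_conjDiagonal_mulVec, ← Complex.ofReal_sub, Complex.zero_le_real,
    sub_nonneg] at hquad
  have hlow : a i * N ≤ ∑ k, a k * Complex.normSq ((Uᴴ *ᵥ v) k) := by
    rw [show N = _ from (sum_normSq_mulVec hU v).symm, Finset.mul_sum]
    refine Finset.sum_le_sum fun k _ => ?_
    rcases le_or_gt k i with hk | hk
    · exact mul_le_mul_of_nonneg_right (ha hk) (Complex.normSq_nonneg _)
    · simp [hUv k hk]
  have hup : ∑ k, b k * Complex.normSq ((Vᴴ *ᵥ v) k) ≤ b i * N := by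
    rw [show N = _ from (sum_normSq_mulVec hV v).symm, Finset.mul_sum]
    refine Finset.sum_le_sum fun k _ => ?_
    rcases le_or_gt i k with hk | hk
    · exact mul_le_mul_of_nonneg_right (hb hk) (Complex.normSq_nonneg _)
    · simp [hVv k hk]
  exact le_of_mul_le_mul_right (hlow.trans (hquad.trans hup)) hN

/-- Lidskii's theorem, in terms of the functions `t ↦ (t - s)⁺`. -/
theorem sum_posPart_eigenvalues_sub_le {d : ℕ} {U V W : Matrix (Fin d) (Fin d) ℂ}
    (hU : U ∈ Matrix.unitaryGroup (Fin d) ℂ) (hV : V ∈ Matrix.unitaryGroup (Fin d) ℂ)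
    (hW : W ∈ Matrix.unitaryGroup (Fin d) ℂ) {a b c : Fin d → ℝ} (ha : Antitone a)
    (hb : Antitone b) (h : conjDiagonal U a - conjDiagonal V b = conjDiagonal W c) (s : ℝ) :
    ∑ i, max (a i - b i - s) 0 ≤ ∑ i, max (c i - s) 0 := by
  -- `P` is the positive part of `A - B - s`, where `A` and `B` are the two matrices being
  -- subtracted. Thus `B + P` dominates both `B` and `A - s`, and by Weyl its eigenvalues `g`
  -- dominate `b` and `a - s`. The trace of `P` then bounds the sum of `g - b`.
  set P := conjDiagonal W fun i => max (c i - s) 0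
  have hP : P.PosSemidef := conjDiagonal_posSemidef W fun i => le_max_right _ _
  have hH : (conjDiagonal V b + P).IsHermitian :=
    Matrix.IsHermitian.add (conjDiagonal_conjTranspose V b) hP.isHermitian
  obtain ⟨Y, hY, g, hg, hYg⟩ := exists_eq_conjDiagonal_antitone hH
  have h1 : ∀ i, b i ≤ g i := le_of_posSemidef_conjDiagonal_sub hV hY hb hg (by
    rw [← hYg]; simpa using hP)
  have h2 : ∀ i, (a - fun _ => s : Fin d → ℝ) i ≤ g i := by
    refine le_of_posSemidef_conjDiagonal_sub hU hY (fun i j hij => ?_) hg ?_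
    · exact sub_le_sub_right (ha hij) s
    · have : conjDiagonal Y g - conjDiagonal U (a - fun _ => s) =
          conjDiagonal W ((fun i => max (c i - s) 0) - (c - fun _ => s)) := by
        rw [← hYg, conjDiagonal_sub, conjDiagonal_sub, conjDiagonal_sub, conjDiagonal_const hU,
          conjDiagonal_const hW, ← h]
        abel
      rw [this]
      exact conjDiagonal_posSemidef W fun i => sub_nonneg.2 (le_max_left _ _)
  have h3 : ∑ i, g i = ∑ i, b i + ∑ i, max (c i - s) 0 := by
    have := congrArg Matrix.trace hYg
    rw [Matrix.trace_add, trace_conjDiagonal hV, trace_conjDiagonal hY, trace_conjDiagonal hW,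
      ← Complex.ofReal_add] at this
    exact (Complex.ofReal_injective this).symm
  calc ∑ i, max (a i - b i - s) 0 ≤ ∑ i, (g i - b i) := Finset.sum_le_sum fun i _ => by
        have := h2 i
        exact max_le (by change a i - s ≤ g i at this; linarith) (sub_nonneg.2 (h1 i))
    _ = _ := by rw [Finset.sum_sub_distrib, h3]; ring

theorem norm_toLp_eigenvalues_sub_le {d : ℕ} (p : ℝ≥0∞) [Fact (1 ≤ p)]
    {U V W : Matrix (Fin d) (Fin d) ℂ}
    (hU : U ∈ Matrix.unitaryGroup (Fin d) ℂ) (hV : V ∈ Matrix.unitaryGroup (Fin d) ℂ)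
    (hW : W ∈ Matrix.unitaryGroup (Fin d) ℂ) {a b c : Fin d → ℝ} (ha : Antitone a)
    (hb : Antitone b) (hc : Antitone c)
    (h : conjDiagonal U a - conjDiagonal V b = conjDiagonal W c) :
    ‖WithLp.toLp p (a - b)‖ ≤ ‖WithLp.toLp p c‖ := by
  refine norm_toLp_le_of_sum_posPart_le p hc ?_
    (sum_posPart_eigenvalues_sub_le hU hV hW ha hb h)
  have := congrArg Matrix.trace h
  rw [Matrix.trace_sub, trace_conjDiagonal hU, trace_conjDiagonal hV, trace_conjDiagonal hW,
    ← Complex.ofReal_sub] at this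
  rw [← Complex.ofReal_injective this]
  simp

/-! ### Schatten norms -/

theorem trace_cfc_conjDiagonal {d : ℕ} {U : Matrix (Fin d) (Fin d) ℂ}
    (hU : U ∈ Matrix.unitaryGroup (Fin d) ℂ) (r : Fin d → ℝ) (f : ℝ → ℝ) :
    (cfc f (conjDiagonal U r)).trace = ((∑ i, f (r i) : ℝ) : ℂ) := by
  have hH : (conjDiagonal U r).IsHermitian := conjDiagonal_conjTranspose U r
  have h1 : (cfc f (conjDiagonal U r)).trace = ((∑ i, f (hH.eigenvalues i) : ℝ) : ℂ) := by
    rw [hH.cfc_eq, Matrix.IsHermitian.cfc, Unitary.conjStarAlgAut_apply, Matrix.trace_mul_comm,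
      ← Matrix.mul_assoc]
    simp [Matrix.trace_diagonal]
  -- The library's eigenvalues and `r` may be ordered differently; they agree as the multiset of
  -- roots of the characteristic polynomial, which suffices for a symmetric sum.
  have h2 : (conjDiagonal U r).charpoly.roots =
      Multiset.map (fun i => (r i : ℂ)) Finset.univ.val := by
    rw [conjDiagonal, Matrix.charpoly_mul_comm, ← Matrix.mul_assoc,
      conjTranspose_mul_self_of_mem hU, Matrix.one_mul, Matrix.charpoly_diagonal,
      Polynomial.roots_prod _ _ (Finset.prod_ne_zero_iff.2 fun i _ => Polynomial.X_sub_C_ne_zero _)]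
    simp [Multiset.bind_singleton]
  have h3 := hH.roots_charpoly_eq_eigenvalues
  rw [h2] at h3
  have h4 := congrArg (fun m : Multiset ℂ => (m.map fun z => f z.re).sum) h3
  simp only [Multiset.map_map] at h4
  rw [h1]
  congr 1
  exact h4.symm

theorem schattenNorm_conjDiagonal {d : ℕ} {p : ℝ≥0∞} (hp : 1 ≤ p)
    {U : Matrix (Fin d) (Fin d) ℂ} (hU : U ∈ Matrix.unitaryGroup (Fin d) ℂ) (r : Fin d → ℝ) :
    schattenNorm p (conjDiagonal U r) = ‖WithLp.toLp p r‖ := by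
  rcases eq_or_ne p ∞ with rfl | hpt
  · rw [schattenNorm, if_pos rfl]
    open scoped Matrix.Norms.L2Operator in
    rw [Matrix.l2_opNorm_toEuclideanCLM, conjDiagonal,
      CStarRing.norm_mul_mem_unitary _ (conjTranspose_mem_unitaryGroup hU),
      CStarRing.norm_mem_unitary_mul _ hU, Matrix.l2_opNorm_diagonal]
    rw [PiLp.norm_toLp]
    simp [Pi.norm_def]
  · have hp0 : 0 < p.toReal := ENNReal.toReal_pos (by positivity) hpt
    rw [schattenNorm, if_neg hpt, conjDiagonal_conjTranspose, conjDiagonal_mul hU,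
      trace_cfc_conjDiagonal hU, Complex.ofReal_re, PiLp.norm_eq_sum hp0]
    congr 1
    refine Finset.sum_congr rfl fun i _ => ?_
    rw [Pi.mul_apply, ← abs_mul_abs_self, ← pow_two, ← Real.rpow_natCast,
      ← Real.rpow_mul (abs_nonneg _), Real.norm_eq_abs]
    congr 1
    push_cast
    ring

/-! ### Uniform mixtures of unitaries -/

theorem conjTranspose_mul_conjDiagonal_mul {d : ℕ} {U : Matrix (Fin d) (Fin d) ℂ}
    (hU : U ∈ Matrix.unitaryGroup (Fin d) ℂ) (r : Fin d → ℝ) :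
    Uᴴ * conjDiagonal U r * U = Matrix.diagonal fun i => (r i : ℂ) := by
  have hUU := conjTranspose_mul_self_of_mem hU
  rw [conjDiagonal, ← Matrix.mul_assoc, ← Matrix.mul_assoc, hUU, Matrix.one_mul,
    Matrix.mul_assoc, hUU, Matrix.mul_one]

/-- `B` is a uniform mixture of finitely many unitary conjugates of `A`. -/
def UniformlyMixes {d : ℕ} (A B : Matrix (Fin d) (Fin d) ℂ) : Prop :=
  ∃ (m : ℕ) (V : Fin m → Matrix (Fin d) (Fin d) ℂ), 1 ≤ m ∧
    (∀ i, V i ∈ Matrix.unitaryGroup (Fin d) ℂ) ∧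
    B = (1 / (m : ℂ)) • ∑ i, V i * A * (V i)ᴴ

theorem UniformlyMixes.conj {d : ℕ} (A : Matrix (Fin d) (Fin d) ℂ)
    {U : Matrix (Fin d) (Fin d) ℂ} (hU : U ∈ Matrix.unitaryGroup (Fin d) ℂ) :
    UniformlyMixes A (U * A * Uᴴ) :=
  ⟨1, fun _ => U, le_rfl, fun _ => hU, by simp⟩

theorem UniformlyMixes.refl {d : ℕ} (A : Matrix (Fin d) (Fin d) ℂ) : UniformlyMixes A A := by
  simpa using UniformlyMixes.conj A (one_mem (Matrix.unitaryGroup (Fin d) ℂ))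

theorem UniformlyMixes.trans {d : ℕ} {A B C : Matrix (Fin d) (Fin d) ℂ}
    (h₁ : UniformlyMixes A B) (h₂ : UniformlyMixes B C) : UniformlyMixes A C := by
  obtain ⟨m, V, hm, hV, rfl⟩ := h₁
  obtain ⟨n, W, hn, hW, rfl⟩ := h₂
  refine ⟨n * m, fun k => W (finProdFinEquiv.symm k).1 * V (finProdFinEquiv.symm k).2,
    Nat.mul_pos hn hm, fun k => mul_mem (hW _) (hV _), ?_⟩
  rw [Equiv.sum_comp finProdFinEquiv.symm fun k : Fin n × Fin m =>
    W k.1 * V k.2 * A * (W k.1 * V k.2)ᴴ, Fintype.sum_prod_type]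
  simp only [Matrix.mul_smul, Matrix.smul_mul, ← Finset.smul_sum, smul_smul]
  congr 1
  · push_cast
    rw [one_div_mul_one_div]
  · refine Finset.sum_congr rfl fun i _ => ?_
    rw [Matrix.mul_sum, Matrix.sum_mul]
    refine Finset.sum_congr rfl fun j _ => ?_
    simp only [Matrix.conjTranspose_mul, Matrix.mul_assoc]

/-- The weights `t` and `1 - t` are moved into the unitaries, so that the mixture stays uniform even
for irrational `t`. With `P` the swap, `√t • 1 ± i√(1 - t) • P` are unitary because `P` is a
Hermitian involution. Averaging the two conjugations cancels the cross terms and leaves `t • D + (1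
- t) • P D P`. -/
theorem UniformlyMixes.of_tTransform {d : ℕ} {x x' : Fin d → ℝ} (h : TTransform x x') :
    UniformlyMixes (Matrix.diagonal fun i => (x i : ℂ)) (Matrix.diagonal fun i => (x' i : ℂ)) := by
  obtain ⟨i, j, t, h0, h1, rfl⟩ := h
  set D : Matrix (Fin d) (Fin d) ℂ := Matrix.diagonal fun i => (x i : ℂ)
  set P : Matrix (Fin d) (Fin d) ℂ := (Equiv.swap i j).permMatrix ℂ with hPdef
  have hPP : P * P = 1 := by
    rw [hPdef, ← Matrix.permMatrix_mul]; simp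
  have hPH : Pᴴ = P := by
    rw [hPdef, Matrix.conjTranspose_permMatrix]; simp
  have hPDP : P * D * P = Matrix.diagonal fun k => (x (Equiv.swap i j k) : ℂ) := by
    rw [hPdef, Equiv.Perm.permMatrix, PEquiv.toMatrix_toPEquiv_mul, PEquiv.mul_toMatrix_toPEquiv,
      Matrix.submatrix_submatrix]
    exact Matrix.submatrix_diagonal_equiv (fun i => (x i : ℂ)) (Equiv.swap i j)
  set c : ℂ := (Real.sqrt t : ℂ)
  set s : ℂ := (Real.sqrt (1 - t) : ℂ)
  have hc : c * c = t := by
    rw [← Complex.ofReal_mul, Real.mul_self_sqrt h0]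
  have hs : s * s = ((1 - t : ℝ) : ℂ) := by
    rw [← Complex.ofReal_mul, Real.mul_self_sqrt (sub_nonneg.2 h1)]
  have hcs : star c = c := Complex.conj_ofReal _
  have hss : star s = s := Complex.conj_ofReal _
  have hI : star Complex.I = -Complex.I := Complex.conj_I
  let V : ℂ → Matrix (Fin d) (Fin d) ℂ := fun z => c • (1 : Matrix (Fin d) (Fin d) ℂ) + z • P
  have hVH : ∀ z, (V z)ᴴ = c • (1 : Matrix (Fin d) (Fin d) ℂ) + star z • P := fun z => by
    simp [V, hPH, hcs]
  have hV : ∀ z : ℂ, star z = -z → z * z = -((1 - t : ℝ) : ℂ) →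
      V z ∈ Matrix.unitaryGroup (Fin d) ℂ := fun z hz hz2 => by
    rw [Matrix.mem_unitaryGroup_iff, Matrix.star_eq_conjTranspose, hVH, hz]
    simp only [V, Matrix.add_mul, Matrix.mul_add, Matrix.smul_mul, Matrix.mul_smul,
      Matrix.one_mul, Matrix.mul_one, hPP]
    have : (c * c + -z * z) • (1 : Matrix (Fin d) (Fin d) ℂ) = 1 := by
      rw [hc, neg_mul, hz2]; simp
    refine Eq.trans ?_ this
    module
  have hz : ∀ e : ℂ, star e = e → e * e = 1 → V (e * Complex.I * s) ∈
      Matrix.unitaryGroup (Fin d) ℂ := fun e he he2 => by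
    refine hV _ ?_ ?_
    · rw [star_mul', star_mul', he, hI, hss]; ring
    · rw [← hs]
      linear_combination Complex.I * Complex.I * s * s * he2 + s * s * Complex.I_mul_I
  refine ⟨2, ![V (1 * Complex.I * s), V ((-1) * Complex.I * s)], by norm_num, ?_, ?_⟩
  · intro k
    fin_cases k
    · exact hz 1 (by simp) (by simp)
    · exact hz (-1) (by simp) (by simp)
  · have hD : (Matrix.diagonal fun k =>
        (((t • x + (1 - t) • (x ∘ Equiv.swap i j) : Fin d → ℝ) k : ℝ) : ℂ)) =
        (c * c) • D + (s * s) • (P * D * P) := by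
      rw [hPDP, hc, hs]
      ext a b
      by_cases hab : a = b
      · subst hab; simp [D]
      · simp [D, hab]
    rw [hD, Fin.sum_univ_two]
    simp only [Matrix.cons_val_zero, Matrix.cons_val_one, hVH, star_mul', hI, hss, star_one,
      star_neg]
    simp only [V, Matrix.add_mul, Matrix.mul_add, Matrix.smul_mul, Matrix.mul_smul,
      Matrix.one_mul, Matrix.mul_one]
    have hII : Complex.I * Complex.I = -1 := Complex.I_mul_I
    match_scalars
    · ring
    · linear_combination (s * s) * hII
    · ring
    · ring

theorem UniformlyMixes.diagonal {d : ℕ} {x y : Fin d → ℝ}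
    (h : Relation.ReflTransGen TTransform x y) :
    UniformlyMixes (Matrix.diagonal fun i => (x i : ℂ)) (Matrix.diagonal fun i => (y i : ℂ)) := by
  induction h with
  | refl => exact .refl _
  | tail _ hstep ih => exact ih.trans (.of_tTransform hstep)

theorem UniformlyMixes.conjDiagonal {d : ℕ} {U V : Matrix (Fin d) (Fin d) ℂ}
    (hU : U ∈ Matrix.unitaryGroup (Fin d) ℂ) (hV : V ∈ Matrix.unitaryGroup (Fin d) ℂ)
    {x y : Fin d → ℝ} (h : Relation.ReflTransGen TTransform x y) :
    UniformlyMixes (conjDiagonal U x) (conjDiagonal V y) := by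
  have h1 : UniformlyMixes (Nonuniformity.conjDiagonal U x)
      (Matrix.diagonal fun i => (x i : ℂ)) := by
    have := UniformlyMixes.conj (Nonuniformity.conjDiagonal U x)
      (conjTranspose_mem_unitaryGroup hU)
    rwa [Matrix.conjTranspose_conjTranspose, conjTranspose_mul_conjDiagonal_mul hU] at this
  exact (h1.trans (.diagonal h)).trans (.conj _ hV)

/-! ### Free operations -/

/-- The map `A ↦ ∑ i, w i • V i A (V i)ᴴ`. -/
def mixture {d m : ℕ} (w : Fin m → ℝ) (V : Fin m → Matrix (Fin d) (Fin d) ℂ) : SuperOp d :=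
  ∑ i, (w i : ℂ) • (LinearMap.mulRight ℂ (V i)ᴴ ∘ₗ LinearMap.mulLeft ℂ (V i))

theorem mixture_apply {d m : ℕ} (w : Fin m → ℝ) (V : Fin m → Matrix (Fin d) (Fin d) ℂ)
    (A : Matrix (Fin d) (Fin d) ℂ) :
    mixture w V A = ∑ i, (w i : ℂ) • (V i * A * (V i)ᴴ) := by
  simp [mixture]

theorem partialTrace_blockDiagonal {d m : ℕ} (M : Fin m → Matrix (Fin d) (Fin d) ℂ) :
    partialTrace (Matrix.blockDiagonal M) = ∑ k, M k := by
  ext i j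
  simp [partialTrace, Matrix.sum_apply]

theorem partialTrace_eq_sum_submatrix {d m : ℕ}
    (M : Matrix (Fin d × Fin m) (Fin d × Fin m) ℂ) :
    partialTrace M = ∑ k, M.submatrix (fun i => (i, k)) fun i => (i, k) := by
  ext i j
  simp [partialTrace, Matrix.sum_apply]

theorem kronecker_maxMixed {d m : ℕ} (A : Matrix (Fin d) (Fin d) ℂ) :
    A ⊗ₖ maxMixed m = Matrix.blockDiagonal fun _ : Fin m => (1 / (m : ℂ)) • A := by
  rw [maxMixed, Matrix.kronecker_smul, Matrix.kronecker_one]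
  exact (Matrix.blockDiagonal_smul _ _).symm

theorem mixture_isMixtureOfUnitaries {d m : ℕ} {w : Fin m → ℝ}
    {V : Fin m → Matrix (Fin d) (Fin d) ℂ} (hw : w ∈ stdSimplex ℝ (Fin m))
    (hV : ∀ i, V i ∈ Matrix.unitaryGroup (Fin d) ℂ) : IsMixtureOfUnitaries (mixture w V) :=
  ⟨m, w, V, hw, hV, mixture_apply w V⟩

/-- The joint unitary is a controlled one: the environment index `i` selects `V i`, and the
maximally mixed environment gives every index weight `1 / m`. Uniform weights are what this
construction needs. -/
theorem uniform_mixture_isNoisy {d m : ℕ} {V : Fin m → Matrix (Fin d) (Fin d) ℂ} (hm : 1 ≤ m)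
    (hV : ∀ i, V i ∈ Matrix.unitaryGroup (Fin d) ℂ) :
    IsNoisy (mixture (fun _ => 1 / (m : ℝ)) V) := by
  refine ⟨m, Matrix.blockDiagonal V, hm, ?_, fun A => ?_⟩
  · rw [Matrix.mem_unitaryGroup_iff, Matrix.star_eq_conjTranspose,
      Matrix.blockDiagonal_conjTranspose, ← Matrix.blockDiagonal_mul]
    simp only [mul_conjTranspose_self_of_mem (hV _)]
    exact Matrix.blockDiagonal_one
  · rw [kronecker_maxMixed, Matrix.blockDiagonal_conjTranspose, ← Matrix.blockDiagonal_mul,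
      ← Matrix.blockDiagonal_mul, partialTrace_blockDiagonal, mixture_apply]
    simp

theorem IsMixtureOfUnitaries.isUnital {d : ℕ} {E : SuperOp d} (hE : IsMixtureOfUnitaries E) :
    IsUnital E := by
  obtain ⟨m, w, U, hw, hU, h⟩ := hE
  have hsum : ∑ i, (w i : ℂ) = 1 := by rw [← Complex.ofReal_sum, hw.2, Complex.ofReal_one]
  refine ⟨⟨fun k M hM => ?_, fun A => ?_⟩, ?_⟩
  -- Ampliation turns conjugation by `U i` into conjugation by `1 ⊗ U i`, so complete positivity is
  -- visible termwise.
  · have hamp : ampliation k E M = ∑ i, (w i : ℂ) •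
        (((1 : Matrix (Fin k) (Fin k) ℂ) ⊗ₖ U i) * M * ((1 : Matrix (Fin k) (Fin k) ℂ) ⊗ₖ U i)ᴴ) := by
      ext a b
      simp only [ampliation, Matrix.of_apply, h, Matrix.sum_apply, Matrix.smul_apply]
      refine Finset.sum_congr rfl fun i _ => ?_
      simp [Matrix.mul_apply, Fintype.sum_prod_type, Matrix.kroneckerMap_apply,
        Matrix.one_apply, ite_mul]
      refine Or.inl ?_
      rw [Finset.sum_comm]
      refine Finset.sum_congr rfl fun j _ => ?_
      simp [apply_ite (starRingEnd ℂ)]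
    rw [hamp]
    refine Matrix.posSemidef_sum _ fun i _ => ?_
    exact (hM.mul_mul_conjTranspose_same _).smul (by simpa using hw.1 i)
  · rw [h, Matrix.trace_sum]
    have : ∀ i, ((w i : ℂ) • (U i * A * (U i)ᴴ)).trace = (w i : ℂ) * A.trace := fun i => by
      rw [Matrix.trace_smul, Matrix.trace_mul_comm, ← Matrix.mul_assoc,
        conjTranspose_mul_self_of_mem (hU i), Matrix.one_mul, smul_eq_mul]
    simp only [this, ← Finset.sum_mul, hsum, one_mul]
  · rw [h, maxMixed]
    simp only [Matrix.mul_smul, Matrix.smul_mul, Matrix.mul_one,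
      mul_conjTranspose_self_of_mem (hU _), ← Finset.sum_smul, hsum, one_smul]

theorem UniformlyMixes.converts {d : ℕ} (X : FreeClass) {ρ σ : State d}
    (h : UniformlyMixes ρ.mat σ.mat) : Converts X ρ σ := by
  obtain ⟨m, V, hm, hV, hσ⟩ := h
  have hm0 : (m : ℝ) ≠ 0 := by positivity
  have hMU : IsMixtureOfUnitaries (mixture (fun _ => 1 / (m : ℝ)) V) :=
    mixture_isMixtureOfUnitaries ⟨fun _ => by positivity, by simp [hm0]⟩ hV
  refine ⟨mixture (fun _ => 1 / (m : ℝ)) V, ?_, ?_⟩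
  · cases X
    · exact hMU
    · exact uniform_mixture_isNoisy hm hV
    · exact hMU.isUnital
  · rw [hσ, mixture_apply, Finset.smul_sum]
    simp

/-! ### Free conversion implies majorization -/

/-- The properties shared by all free operations that force majorization. -/
structure IsPositiveUnital {d : ℕ} (E : SuperOp d) : Prop where
  posSemidef : ∀ A : Matrix (Fin d) (Fin d) ℂ, A.PosSemidef → (E A).PosSemidef
  trace : ∀ A, (E A).trace = A.trace
  one : E 1 = 1

theorem IsUnital.isPositiveUnital {d : ℕ} {E : SuperOp d} (hE : IsUnital E) :
    IsPositiveUnital E := by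
  refine ⟨fun A hA => ?_, hE.1.tracePreserving, ?_⟩
  -- Plain positivity is complete positivity with a one-dimensional ancilla.
  · have := (hE.1.completelyPositive 1 (A.submatrix Prod.snd Prod.snd) (hA.submatrix _)).submatrix
      fun i : Fin d => ((0 : Fin 1), i)
    exact this
  -- The factor `1 / d` can be cancelled only for `d ≠ 0`; in dimension zero all matrices coincide.
  · rcases Nat.eq_zero_or_pos d with rfl | hd
    · exact Subsingleton.elim _ _
    · have h := hE.2
      rw [maxMixed, map_smul] at h
      exact smul_right_injective _ (one_div_ne_zero (Nat.cast_ne_zero.2 hd.ne')) h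

theorem IsNoisy.isPositiveUnital {d : ℕ} {E : SuperOp d} (hE : IsNoisy E) :
    IsPositiveUnital E := by
  obtain ⟨m, U, hm, hU, h⟩ := hE
  have hm0 : (m : ℂ) ≠ 0 := by
    have : m ≠ 0 := by omega
    exact_mod_cast this
  have hmix : (maxMixed m).PosSemidef :=
    Matrix.PosSemidef.one.smul (by positivity)
  have htr : ∀ M : Matrix (Fin d × Fin m) (Fin d × Fin m) ℂ,
      (partialTrace M).trace = M.trace := fun M => by
    simp [partialTrace, Matrix.trace, Fintype.sum_prod_type]
  refine ⟨fun A hA => ?_, fun A => ?_, ?_⟩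
  · rw [h, partialTrace_eq_sum_submatrix]
    exact Matrix.posSemidef_sum _ fun k _ =>
      ((hA.kronecker hmix).mul_mul_conjTranspose_same U).submatrix _
  · rw [h, htr, Matrix.trace_mul_comm, ← Matrix.mul_assoc, conjTranspose_mul_self_of_mem hU,
      Matrix.one_mul, Matrix.trace_kronecker]
    simp [maxMixed, Matrix.trace_smul, hm0]
  · rw [h, maxMixed, Matrix.kronecker_smul, Matrix.one_kronecker_one, Matrix.mul_smul,
      Matrix.mul_one, Matrix.smul_mul, mul_conjTranspose_self_of_mem hU,
      partialTrace_eq_sum_submatrix]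
    simp only [Matrix.submatrix_smul]
    have : ∀ k : Fin m, (1 : Matrix (Fin d × Fin m) (Fin d × Fin m) ℂ).submatrix
        (fun i => (i, k)) (fun i => (i, k)) = 1 := fun k =>
      Matrix.submatrix_one _ (Prod.mk_left_injective k)
    simp [this, ← Nat.cast_smul_eq_nsmul ℂ, smul_smul, hm0]

theorem IsFree.isPositiveUnital {d : ℕ} {X : FreeClass} {E : SuperOp d} (hE : IsFree X E) :
    IsPositiveUnital E := by
  cases X
  · exact (IsMixtureOfUnitaries.isUnital hE).isPositiveUnital
  · exact IsNoisy.isPositiveUnital hE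
  · exact IsUnital.isPositiveUnital hE

/-- The transition matrix has as entry `(j, i)` the `j`-th diagonal element, in the basis `V`, of
the image of the `i`-th eigenprojection of `U`. Positivity makes the entries nonnegative, unitality
makes the rows sum to one, and trace preservation the columns. -/
theorem partialSum_le_of_isPositiveUnital {d : ℕ} {E : SuperOp d} (hE : IsPositiveUnital E)
    {U V : Matrix (Fin d) (Fin d) ℂ} (hU : U ∈ Matrix.unitaryGroup (Fin d) ℂ)
    (hV : V ∈ Matrix.unitaryGroup (Fin d) ℂ) {x y : Fin d → ℝ} (hx : Antitone x)
    (h : conjDiagonal V y = E (conjDiagonal U x)) (k : ℕ) : partialSum k y ≤ partialSum k x := by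
  set Q : Fin d → Matrix (Fin d) (Fin d) ℂ := fun i => conjDiagonal U (Pi.single i 1)
  set F : Fin d → Matrix (Fin d) (Fin d) ℂ := fun i => Vᴴ * E (Q i) * V
  have hF : ∀ i, (F i).PosSemidef := fun i =>
    (hE.posSemidef _ (conjDiagonal_posSemidef U fun j => by
      by_cases hj : j = i
      · subst hj; simp
      · simp [hj])).conjTranspose_mul_mul_same V
  have hlin : ∀ r : Fin d → ℝ, Vᴴ * E (conjDiagonal U r) * V = ∑ i, (r i : ℂ) • F i := fun r => by
    have : conjDiagonal U r = ∑ i, (r i : ℂ) • Q i := by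
      have hd : Matrix.diagonal (fun i => (r i : ℂ)) = ∑ i, (r i : ℂ) •
          Matrix.diagonal (fun j => ((Pi.single i 1 : Fin d → ℝ) j : ℂ)) := by
        ext a b
        by_cases hab : a = b
        · subst hab
          simp [Matrix.sum_apply, Pi.single_apply, apply_ite ((↑) : ℝ → ℂ)]
        · simp [Matrix.sum_apply, hab]
      rw [conjDiagonal, hd]
      simp [Q, conjDiagonal, Matrix.mul_sum, Matrix.sum_mul]
    rw [this, map_sum]
    simp [F, Matrix.mul_sum, Matrix.sum_mul]
  have hVV := conjTranspose_mul_self_of_mem hV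
  refine partialSum_le_of_doublyStochastic (D := fun j i => (F i j j).re) (fun j i => ?_)
    (fun j => ?_) (fun i => ?_) (fun j => ?_) hx k
  · exact (Complex.nonneg_iff.1 ((hF i).diag_nonneg (i := j))).1
  · have := hlin fun _ => 1
    rw [conjDiagonal_const hU, Complex.ofReal_one, one_smul, hE.one, Matrix.mul_one, hVV] at this
    have := congrArg Complex.re (congrFun (congrFun this j) j)
    simpa [Matrix.sum_apply] using this.symm
  · have : (F i).trace = 1 := by
      rw [Matrix.trace_mul_comm, ← Matrix.mul_assoc, mul_conjTranspose_self_of_mem hV,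
        Matrix.one_mul, hE.trace, trace_conjDiagonal hU]
      simp
    have := congrArg Complex.re this
    simpa [Matrix.trace] using this
  · have hy := conjTranspose_mul_conjDiagonal_mul hV y
    rw [h, hlin] at hy
    have := congrArg Complex.re (congrFun (congrFun hy j) j)
    simp only [Matrix.sum_apply, Matrix.smul_apply, Matrix.diagonal_apply_eq, Complex.re_sum,
      smul_eq_mul, Complex.re_ofReal_mul, Complex.ofReal_re] at this
    rw [← this]
    exact Finset.sum_congr rfl fun i _ => mul_comm _ _

theorem Converts.majorizes {d : ℕ} {X : FreeClass} {ρ σ : State d} (h : Converts X ρ σ) :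
    Majorizes (spec ρ : Fin d → ℝ) (spec σ) := by
  obtain ⟨E, hE, hσ⟩ := h
  obtain ⟨U, hU, hρU⟩ := exists_eq_conjDiagonal_spec ρ
  obtain ⟨V, hV, hσV⟩ := exists_eq_conjDiagonal_spec σ
  rw [hρU, hσV] at hσ
  exact (majorizes_iff_partialSum_le (spec ρ).2 (spec σ).2).2
    (partialSum_le_of_isPositiveUnital (IsFree.isPositiveUnital hE) hU hV (spec ρ).2.2 hσ)

theorem converts_of_majorizes {d : ℕ} (X : FreeClass) {ρ σ : State d}
    {U V : Matrix (Fin d) (Fin d) ℂ} (hU : U ∈ Matrix.unitaryGroup (Fin d) ℂ)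
    (hV : V ∈ Matrix.unitaryGroup (Fin d) ℂ) {x y : orderedSimplex d}
    (hρ : ρ.mat = conjDiagonal U x) (hσ : σ.mat = conjDiagonal V y)
    (h : Majorizes (x : Fin d → ℝ) y) : Converts X ρ σ := by
  refine UniformlyMixes.converts X ?_
  rw [hρ, hσ]
  exact .conjDiagonal hU hV (reflTransGen_tTransform y.2.2 (x.2.1.2.trans y.2.1.2.symm)
    ((majorizes_iff_partialSum_le x.2 y.2).1 h))

/-! ### Distances -/

theorem lpDist_spec_le_schattenDist {d : ℕ} {p : ℝ≥0∞} (hp : 1 ≤ p) (ρ σ : State d) :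
    lpDist p (spec ρ) (spec σ) ≤ schattenDist p ρ σ := by
  have : Fact (1 ≤ p) := ⟨hp⟩
  obtain ⟨U, hU, hρ⟩ := exists_eq_conjDiagonal_spec ρ
  obtain ⟨V, hV, hσ⟩ := exists_eq_conjDiagonal_spec σ
  obtain ⟨W, hW, c, hc, hWc⟩ := exists_eq_conjDiagonal_antitone
    (ρ.posSemidef.isHermitian.sub σ.posSemidef.isHermitian)
  rw [schattenDist, hWc, schattenNorm_conjDiagonal hp hW]
  rw [hρ, hσ] at hWc
  exact norm_toLp_eigenvalues_sub_le p hU hV hW (spec ρ).2.2 (spec σ).2.2 hc hWc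

theorem lpDist_comm {d : ℕ} {p : ℝ≥0∞} (hp : 1 ≤ p) (x y : orderedSimplex d) :
    lpDist p x y = lpDist p y x := by
  have : Fact (1 ≤ p) := ⟨hp⟩
  rw [lpDist, lpDist, WithLp.toLp_sub, WithLp.toLp_sub, norm_sub_rev]

/-- In a common eigenbasis the difference of the states is diagonal with entries `x - y`, so
Lidskii's bound is attained. -/
theorem schattenDist_conjDiagonalState {d : ℕ} {p : ℝ≥0∞} (hp : 1 ≤ p) {ρ : State d}
    {U : Matrix (Fin d) (Fin d) ℂ} (hU : U ∈ Matrix.unitaryGroup (Fin d) ℂ)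
    {x : orderedSimplex d} (hρ : ρ.mat = conjDiagonal U x) (y : orderedSimplex d) :
    schattenDist p ρ (conjDiagonalState hU y) = lpDist p x y := by
  rw [schattenDist, hρ, conjDiagonalState, ← conjDiagonal_sub, schattenNorm_conjDiagonal hp hU,
    lpDist]

theorem postConverts_iff_postMajorizes {d : ℕ} (X : FreeClass) {p : ℝ≥0∞} (hp : 1 ≤ p) (ε : ℝ)
    (ρ σ : State d) :
    PostConverts X (schattenDist p) ε ρ σ ↔ PostMajorizes (lpDist p) ε (spec ρ) (spec σ) := by
  constructor
  · rintro ⟨σ', h, hε⟩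
    refine ⟨spec σ', h.majorizes, ?_⟩
    rw [lpDist_comm hp]
    exact (lpDist_spec_le_schattenDist hp σ σ').trans hε
  · rintro ⟨y, h, hε⟩
    obtain ⟨U, hU, hρ⟩ := exists_eq_conjDiagonal_spec ρ
    obtain ⟨V, hV, hσ⟩ := exists_eq_conjDiagonal_spec σ
    refine ⟨conjDiagonalState hV y, converts_of_majorizes X hU hV hρ rfl h, ?_⟩
    rwa [schattenDist_conjDiagonalState hp hV hσ, lpDist_comm hp]

theorem preConverts_iff_preMajorizes {d : ℕ} (X : FreeClass) {p : ℝ≥0∞} (hp : 1 ≤ p) (ε : ℝ)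
    (ρ σ : State d) :
    PreConverts X (schattenDist p) ε ρ σ ↔ PreMajorizes (lpDist p) ε (spec ρ) (spec σ) := by
  constructor
  · rintro ⟨ρ', h, hε⟩
    refine ⟨spec ρ', h.majorizes, ?_⟩
    rw [lpDist_comm hp]
    exact (lpDist_spec_le_schattenDist hp ρ ρ').trans hε
  · rintro ⟨x, h, hε⟩
    obtain ⟨U, hU, hρ⟩ := exists_eq_conjDiagonal_spec ρ
    obtain ⟨V, hV, hσ⟩ := exists_eq_conjDiagonal_spec σ
    refine ⟨conjDiagonalState hU x, converts_of_majorizes X hU hV rfl hσ h, ?_⟩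
    rwa [schattenDist_conjDiagonalState hp hU hρ, lpDist_comm hp]

end Nonuniformity

end

theorem theorem8 (d : ℕ) (X : Nonuniformity.FreeClass) (p : ENNReal) (hp : 1 ≤ p)
    (ε : ℝ) (hε : 0 ≤ ε) (ρ σ : Nonuniformity.State d) :
    (Nonuniformity.PostConverts X (Nonuniformity.schattenDist p) ε ρ σ ↔
      Nonuniformity.PostMajorizes (Nonuniformity.lpDist p) ε
        (Nonuniformity.spec ρ) (Nonuniformity.spec σ)) ∧
    (Nonuniformity.PreConverts X (Nonuniformity.schattenDist p) ε ρ σ ↔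
      Nonuniformity.PreMajorizes (Nonuniformity.lpDist p) ε
        (Nonuniformity.spec ρ) (Nonuniformity.spec σ)) :=
  ⟨Nonuniformity.postConverts_iff_postMajorizes X hp ε ρ σ,
    Nonuniformity.preConverts_iff_preMajorizes X hp ε ρ σ⟩
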